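/- Let $Z$ be an integrable real random variable with $\mathbb{E}Z>0$, let $(Z_k)_{k\ge 1}$ be independent copies of $Z$, and put $S_0=0$, $S_n=Z_1+\dots+Z_n$ for $n\ge 1$. Let $H(B)=\sum_{n=0}^\infty \mathbb{P}(S_n\in B)$, for Borel sets $B\subseteq\mathbb{R}$, be the renewal measure of $(S_n)$, and let $H(x)=H((-\infty,x])\in[0,\infty]$ be its renewal function. Assume that 1. $\mathbb{P}(Z>x)=o(e^{-rx})$ as $x\to\infty$ for some $r>0$; 2. the law of $Z$ is strongly non-lattice, that is, $\limsup_{|t|\to\infty}|\mathbb{E}e^{itZ}|<1$; 3. there is $\beta>0$ such that $$\limsup_{h\to 0^+}\ \sup_{a\ge 0}\ h^{-\beta}\,\mathbb{P}(a<Z\le a+h)<\infty .$$ Then there exist $\tilde\beta>0$ and $c>0$ such that, for all $x\ge 0$ and all $h\ge 0$, $$H((x,x+h])\le c\,\max\{h^{\tilde\beta},h\}.$$ In particular, $H(x+h)-H(x)\le c\max\{h^{\tilde\beta},h\}$ whenever $H(x+h)$ is finite. -/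

import Mathlib

open MeasureTheory ProbabilityTheory Filter Topology Set
open scoped ENNReal

noncomputable section

namespace RenewalIncrement

variable {Ω : Type*} [MeasurableSpace Ω]

/-- The random walk with steps `Y 0, Y 1, …`, started at `0`. -/
def walk (Y : ℕ → Ω → ℝ) (n : ℕ) (ω : Ω) : ℝ :=
  ∑ k ∈ Finset.range n, Y k ω

/-- The renewal measure `H(B) = ∑_{n ≥ 0} P(S_n ∈ B)` of the random walk with steps `Y`. -/
def renewalMeasure (P : Measure Ω) (Y : ℕ → Ω → ℝ) : Measure ℝ :=
  Measure.sum fun n : ℕ => P.map (walk Y n)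

/-- The renewal function `H(x) = H((-∞, x])`, with values in `[0, ∞]`. -/
def renewalFunction (P : Measure Ω) (Y : ℕ → Ω → ℝ) (x : ℝ) : ℝ≥0∞ :=
  renewalMeasure P Y (Iic x)

/-- The law of `Z` satisfies Cramér's condition `limsup_{|t| → ∞} |E exp(itZ)| < 1`. -/
def StronglyNonLattice (P : Measure Ω) (Z : Ω → ℝ) : Prop :=
  limsup (fun t : ℝ => ‖charFun (P.map Z) t‖) (comap (fun t : ℝ => |t|) atTop) < 1

end RenewalIncrement

end

namespace RenewalIncrement

/-! For small `h`, split the renewal series at `N = ⌈h ^ (-γ)⌉` with `γ = min β 1 / 4`. Write `φ`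
for the characteristic function of `Z`.

Terms `n < N`: since `x ≥ 0`, a walk beyond `x` has made a positive step. Freezing the other steps
bounds each term by `n` times the concentration of `Z` on the positive half-line
(`measure_walk_Ioc_le`), in total `O(N² h ^ β)`.

Terms `n ≥ N`: dominate the indicator by a Gaussian of width `h` and compare it with `h` times a
Gaussian of width 1. In Fourier space the difference of the two is `O(t²)` at the origin, which
cancels the singularity of `∑ ‖φ‖ ^ n ≤ 1 / (κ t²)`; away from the origin `‖φ‖ ≤ ρ < 1`, which
leaves `O(ρ ^ N)` (`exists_sum_Ico_gaussian_sub_le`). The unit Gaussian sums to a constant uniformly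
in `x`: this is transience (`exists_sum_integral_gaussian_le`), proved by Abel summation and a bound
on `Re (1 - s φ)⁻¹`. So these terms contribute `O(h + ρ ^ N)`.

For larger `h`, cover the interval by unit intervals. -/

/-! ### Modulus of the characteristic function -/

theorem integrable_cexp_mul_I (m : Measure ℝ) [IsFiniteMeasure m] (t : ℝ) :
    Integrable (fun z : ℝ => Complex.exp (t * z * Complex.I)) m := by
  refine Integrable.of_bound (C := 1) (by fun_prop) (ae_of_all _ fun z => ?_)
  rw [← Complex.ofReal_mul, Complex.norm_exp_ofReal_mul_I]

/-- On the unit circle `1 - Re w² = 2 (1 - Re w)(1 + Re w) ≤ 4 (1 - Re w)`. Integrate this after a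
rotation `c` that makes the characteristic function at `t` real and nonnegative. -/
theorem one_sub_norm_charFun_two_mul_le (m : Measure ℝ) [IsProbabilityMeasure m] (t : ℝ) :
    1 - ‖charFun m (2 * t)‖ ≤ 4 * (1 - ‖charFun m t‖) := by
  obtain ⟨c, hc, hct⟩ : ∃ c : ℂ, ‖c‖ = 1 ∧ c * charFun m t = ‖charFun m t‖ := by
    by_cases h0 : charFun m t = 0
    · exact ⟨1, by simp, by simp [h0]⟩
    · have hn : (‖charFun m t‖ : ℂ) ≠ 0 := by simpa using h0
      refine ⟨‖charFun m t‖ / charFun m t, ?_, by field_simp⟩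
      rw [norm_div, Complex.norm_real, norm_norm, div_self (by simpa using h0)]
  set w : ℝ → ℂ := fun z => c * Complex.exp (t * z * Complex.I) with hw
  have hwi : Integrable w m := (integrable_cexp_mul_I m t).const_mul c
  have hw2 : ∀ z, w z ^ 2 = c ^ 2 * Complex.exp ((2 * t : ℝ) * z * Complex.I) := fun z => by
    rw [hw]; simp only [mul_pow, ← Complex.exp_nat_mul]; push_cast; ring_nf
  have hw2i : Integrable (fun z => w z ^ 2) m := by
    simp only [hw2]; exact (integrable_cexp_mul_I m (2 * t)).const_mul _
  have hwn : ∀ z, ‖w z‖ = 1 := fun z => by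
    rw [hw]; simp only [norm_mul, hc, one_mul]
    rw [← Complex.ofReal_mul, Complex.norm_exp_ofReal_mul_I]
  have e1 : ∫ z, (w z).re ∂m = ‖charFun m t‖ := by
    have : ∫ z, (w z).re ∂m = (∫ z, w z ∂m).re := integral_re hwi
    rw [this, hw, integral_const_mul, ← charFun_apply_real, hct, Complex.ofReal_re]
  have e2 : ∫ z, (w z ^ 2).re ∂m ≤ ‖charFun m (2 * t)‖ := by
    have : ∫ z, (w z ^ 2).re ∂m = (∫ z, w z ^ 2 ∂m).re := integral_re hw2i
    rw [this]; simp only [hw2]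
    rw [integral_const_mul, ← charFun_apply_real]
    refine (Complex.re_le_norm _).trans ?_
    simp [hc]
  have e3 : ∫ z, (1 - (w z ^ 2).re) ∂m ≤ ∫ z, 4 * (1 - (w z).re) ∂m := by
    refine integral_mono ((integrable_const _).sub hw2i.re)
      (((integrable_const _).sub hwi.re).const_mul 4) fun z => ?_
    have h1 : (w z).re ^ 2 + (w z).im ^ 2 = 1 := by
      have := Complex.sq_norm (w z)
      rw [hwn, Complex.normSq_apply] at this; nlinarith
    simp only [sq (w z), Complex.mul_re]
    nlinarith [sq_nonneg ((w z).re - 1)]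
  have hr1 : Integrable (fun z => (w z).re) m := hwi.re
  have hr2 : Integrable (fun z => (w z ^ 2).re) m := hw2i.re
  rw [integral_const_mul, integral_sub (integrable_const _) hr2,
    integral_sub (integrable_const _) hr1] at e3
  simp only [integral_const, probReal_univ, smul_eq_mul, mul_one] at e3
  linarith

/-- About `log₂ (T / |t|)` doublings carry `t` past `T`, and each costs a factor 4, hence `(T / t)²`
in total. No second moment is needed. -/
theorem exists_quadratic_le_one_sub_norm_charFun (m : Measure ℝ) [IsProbabilityMeasure m]
    {ρ T : ℝ} (hρ : ρ < 1) (hT : 0 < T) (h : ∀ t, T ≤ |t| → ‖charFun m t‖ ≤ ρ) :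
    ∃ κ : ℝ, 0 < κ ∧ ∀ t, |t| ≤ T → κ * t ^ 2 ≤ 1 - ‖charFun m t‖ := by
  have key : ∀ (k : ℕ) (t : ℝ), T ≤ 2 ^ k * |t| → (1 - ρ) / 4 ^ k ≤ 1 - ‖charFun m t‖ := by
    intro k
    induction k with
    | zero => intro t ht; have := h t (by simpa using ht); simp; linarith
    | succ k ih =>
      intro t ht
      have h1 := ih (2 * t) (by rw [abs_mul, abs_two]; rw [pow_succ] at ht; linarith)
      have h2 := one_sub_norm_charFun_two_mul_le m t
      rw [pow_succ, ← div_div]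
      linarith
  refine ⟨(1 - ρ) / (4 * T ^ 2), by have : 0 < 1 - ρ := by linarith
                                    positivity, fun t ht => ?_⟩
  rcases eq_or_ne t 0 with rfl | h0
  · simp
  have ht0 : 0 < |t| := abs_pos.2 h0
  -- `2 ^ n ≤ T / |t| < 2 ^ (n + 1)`; the doubling beyond `n` accounts for the 4 in `κ`.
  obtain ⟨n, hn1, hn2⟩ := exists_nat_pow_near ((one_le_div ht0).2 ht) one_lt_two
  refine le_trans ?_ (key (n + 1) t ?_)
  · rw [← sq_abs t, div_mul_eq_mul_div, div_le_div_iff₀ (by positivity) (by positivity), mul_assoc]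
    refine mul_le_mul_of_nonneg_left ?_ (by linarith)
    rw [le_div_iff₀ ht0] at hn1
    have : (4 : ℝ) ^ n = (2 ^ n) ^ 2 := by rw [← pow_mul, mul_comm, pow_mul]; norm_num
    rw [pow_succ (4 : ℝ) n, this]
    have : (2 ^ n * |t|) ^ 2 ≤ T ^ 2 := pow_le_pow_left₀ (by positivity) hn1 2
    nlinarith
  · rw [div_lt_iff₀ ht0] at hn2; exact hn2.le

/-! ### Gaussian smoothing in Fourier space -/

theorem integral_gaussian_eq_integral_charFun (ν : Measure ℝ) [IsFiniteMeasure ν] {h : ℝ}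
    (hh : 0 < h) (x : ℝ) :
    ((∫ y, Real.exp (-((y - x) ^ 2 / (2 * h ^ 2))) ∂ν : ℝ) : ℂ) =
      (h / √(2 * Real.pi) : ℝ) * ∫ t : ℝ, (Real.exp (-(h ^ 2 * t ^ 2 / 2)) : ℂ) *
        (Complex.exp (-(t * x) * Complex.I) * charFun ν t) := by
  have hb : 0 < h ^ 2 / 2 := by positivity
  have hF : Integrable (Function.uncurry fun (t y : ℝ) =>
      (Real.exp (-(h ^ 2 * t ^ 2 / 2)) : ℂ) * Complex.exp (t * (y - x) * Complex.I))
      (volume.prod ν) := by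
    have hg : Integrable (fun p : ℝ × ℝ => Real.exp (-(h ^ 2 / 2) * p.1 ^ 2) * (1 : ℝ))
        (volume.prod ν) :=
      (integrable_exp_neg_mul_sq hb).mul_prod (integrable_const (1 : ℝ))
    refine hg.mono' (by fun_prop) (ae_of_all _ fun p => ?_)
    simp only [Function.uncurry]
    rw [norm_mul, ← Complex.ofReal_sub, ← Complex.ofReal_mul, Complex.norm_exp_ofReal_mul_I,
      Complex.norm_real, Real.norm_of_nonneg (Real.exp_nonneg _)]
    apply le_of_eq; ring_nf
  have e1 : ∀ t : ℝ, (Real.exp (-(h ^ 2 * t ^ 2 / 2)) : ℂ) *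
        (Complex.exp (-(t * x) * Complex.I) * charFun ν t) =
      ∫ y, (Real.exp (-(h ^ 2 * t ^ 2 / 2)) : ℂ) * Complex.exp (t * (y - x) * Complex.I) ∂ν := by
    intro t
    rw [integral_const_mul, charFun_apply_real, ← integral_const_mul]
    congr 2; ext y; rw [← Complex.exp_add]; ring_nf
  have e2 : ∀ y : ℝ, ∫ t : ℝ, (Real.exp (-(h ^ 2 * t ^ 2 / 2)) : ℂ) *
        Complex.exp (t * (y - x) * Complex.I) =
      (√(2 * Real.pi) / h * Real.exp (-((y - x) ^ 2 / (2 * h ^ 2))) : ℝ) := by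
    intro y
    have hg := fourierIntegral_gaussian (b := ((h ^ 2 / 2 : ℝ) : ℂ))
      (by rw [Complex.ofReal_re]; exact hb) ((y - x : ℝ) : ℂ)
    have hl : ∫ t : ℝ, (Real.exp (-(h ^ 2 * t ^ 2 / 2)) : ℂ) *
        Complex.exp (t * (y - x) * Complex.I) = ∫ t : ℝ, Complex.exp (Complex.I * ((y - x : ℝ) : ℂ) * t)
          * Complex.exp (-((h ^ 2 / 2 : ℝ) : ℂ) * t ^ 2) := by
      congr 1; ext t; rw [mul_comm]; push_cast; congr 2 <;> ring
    rw [hl, hg]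
    have : (Real.pi / ((h ^ 2 / 2 : ℝ) : ℂ)) ^ (1 / 2 : ℂ) = ((√(2 * Real.pi) / h : ℝ) : ℂ) := by
      rw [← Complex.ofReal_div, show (1 / 2 : ℂ) = ((1 / 2 : ℝ) : ℂ) by push_cast; rfl,
        ← Complex.ofReal_cpow (by positivity), ← Real.sqrt_eq_rpow]
      congr 1
      rw [show Real.pi / (h ^ 2 / 2) = 2 * Real.pi / h ^ 2 by field_simp,
        Real.sqrt_div (by positivity), Real.sqrt_sq hh.le]
    rw [this]; push_cast; congr 2
    have : (h : ℂ) ≠ 0 := by exact_mod_cast hh.ne'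
    field_simp; ring
  simp_rw [e1]
  rw [integral_integral_swap hF]
  simp_rw [e2]
  rw [integral_complex_ofReal, ← Complex.ofReal_mul, integral_const_mul, ← mul_assoc]
  congr 1
  have : √(2 * Real.pi) ≠ 0 := by positivity
  field_simp

/-! ### Transience: uniform bound for unit Gaussian bumps -/

/-- The derivative of the characteristic function at 0 is `i` times the mean, so its imaginary part
is nonzero to first order. -/
theorem exists_mul_abs_le_abs_im_charFun (m : Measure ℝ) [IsProbabilityMeasure m]
    (hint : Integrable id m) (hmean : ∫ z, z ∂m ≠ 0) :
    ∃ c : ℝ, 0 < c ∧ ∃ δ : ℝ, 0 < δ ∧ ∀ t, |t| ≤ δ → c * |t| ≤ |(charFun m t).im| := by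
  have hL : MemLp id ((1 : ℕ) : ℝ≥0∞) m := by simpa using memLp_one_iff_integrable.2 hint
  have hd : HasDerivAt (charFun m) (Complex.I * ((∫ z, z ∂m : ℝ) : ℂ)) 0 := by
    have h1 := iteratedDeriv_charFun_zero hL
    rw [iteratedDeriv_one] at h1
    have h2 : DifferentiableAt ℝ (charFun m) 0 :=
      ((contDiff_charFun hL).differentiable (by simp)) 0
    have h3 := h2.hasDerivAt
    rw [h1] at h3
    simpa using h3
  have hd' : HasDerivAt (fun t => (charFun m t).im) (∫ z, z ∂m) 0 := by
    have h1 : HasDerivAt (fun t => (charFun m t).im)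
        (Complex.imCLM (Complex.I * ((∫ z, z ∂m : ℝ) : ℂ))) 0 :=
      Complex.imCLM.hasFDerivAt.comp_hasDerivAt (0 : ℝ) hd
    convert h1 using 1
    simp
  set μ := ∫ z, z ∂m
  have hμ : 0 < |μ| := abs_pos.2 hmean
  have ho := (hasDerivAt_iff_isLittleO.1 hd').def (half_pos hμ)
  obtain ⟨ε, hε, hb⟩ := Metric.eventually_nhds_iff.1 ho
  refine ⟨|μ| / 2, by positivity, ε / 2, by positivity, fun t ht => ?_⟩
  have h1 := hb (y := t) (by rw [Real.dist_eq, sub_zero]; linarith)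
  simp only [charFun_zero, sub_zero, Real.norm_eq_abs, smul_eq_mul, Complex.ofReal_im] at h1
  have h2 : |t * μ| - |(charFun m t).im| ≤ |(charFun m t).im - t * μ| := by
    rw [abs_sub_comm]; exact abs_sub_abs_le_abs_sub _ _
  rw [abs_mul] at h2
  linarith

/-- With `u = t z`, `1 - cos u ≤ min (u² / 2) 2`; the two regimes meet at `u² = 4`, which gives `5 /
2`. The majorant has the explicit `t`-integral `5 / 2 * π |z|`. -/
theorem one_sub_cos_le_sq_div (t z : ℝ) (ht : t ≠ 0) :
    (1 - Real.cos (t * z)) / t ^ 2 ≤ 5 / 2 * (z ^ 2 * (1 + (t * z) ^ 2)⁻¹) := by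
  have ht2 : 0 < t ^ 2 := by positivity
  have h1 := Real.one_sub_sq_div_two_le_cos (x := t * z)
  have h2 := Real.neg_one_le_cos (t * z)
  rw [div_le_iff₀ ht2]
  have : 5 / 2 * (z ^ 2 * (1 + (t * z) ^ 2)⁻¹) * t ^ 2
    = 5 / 2 * (t * z) ^ 2 / (1 + (t * z) ^ 2) := by field_simp
  rw [this, le_div_iff₀ (by positivity)]
  rcases le_total ((t * z) ^ 2) 4 with h | h
  · nlinarith [sq_nonneg (t * z)]
  · nlinarith [sq_nonneg (t * z)]

/-- By Tonelli: integrating `(1 - cos (t z)) / t²` in `t` costs a multiple of `|z|`, so a first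
moment suffices. -/
theorem integrable_one_sub_re_charFun_div_sq (m : Measure ℝ) [IsProbabilityMeasure m]
    (hint : Integrable id m) : Integrable fun t : ℝ => (1 - (charFun m t).re) / t ^ 2 := by
  have hi : ∀ z : ℝ, Integrable fun t : ℝ => z ^ 2 * (1 + (t * z) ^ 2)⁻¹ := by
    intro z
    rcases eq_or_ne z 0 with rfl | hz
    · simp
    · exact (integrable_inv_one_add_sq.comp_mul_right' hz).const_mul _
  have hval : ∀ z : ℝ, ∫ t : ℝ, z ^ 2 * (1 + (t * z) ^ 2)⁻¹ = Real.pi * |z| := by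
    intro z
    rw [integral_const_mul, Measure.integral_comp_mul_right (fun u : ℝ => (1 + u ^ 2)⁻¹),
      integral_univ_inv_one_add_sq, smul_eq_mul, abs_inv]
    rcases eq_or_ne z 0 with rfl | hz
    · simp
    · rw [← sq_abs z]; field_simp
  have hG : Integrable (fun p : ℝ × ℝ => p.2 ^ 2 * (1 + (p.1 * p.2) ^ 2)⁻¹)
      (volume.prod m) := by
    refine (integrable_prod_iff' (by fun_prop)).2 ⟨ae_of_all _ fun z => hi z, ?_⟩
    have : ∀ z : ℝ, ∫ t : ℝ, ‖z ^ 2 * (1 + (t * z) ^ 2)⁻¹‖ = Real.pi * |z| := by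
      intro z
      rw [← hval]; congr 1; ext t
      exact Real.norm_of_nonneg (by positivity)
    simp only [this]
    exact hint.abs.const_mul _
  have hF : Integrable (fun p : ℝ × ℝ => (1 - Real.cos (p.1 * p.2)) / p.1 ^ 2)
      (volume.prod m) := by
    refine (hG.const_mul (5 / 2)).mono' (Measurable.aestronglyMeasurable (by fun_prop))
      (ae_of_all _ fun p => ?_)
    have h0 : 0 ≤ 1 - Real.cos (p.1 * p.2) := by linarith [Real.cos_le_one (p.1 * p.2)]
    rw [Real.norm_of_nonneg (by positivity)]
    rcases eq_or_ne p.1 0 with h | h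
    · simp only [h]; simp; positivity
    · exact one_sub_cos_le_sq_div _ _ h
  refine hF.integral_prod_left.congr (ae_of_all _ fun t => ?_)
  have hc : Integrable (fun z : ℝ => Real.cos (t * z)) m :=
    Integrable.of_bound (C := 1) (by fun_prop) (ae_of_all _ fun z => Real.abs_cos_le_one _)
  simp only
  rw [integral_div, integral_sub (integrable_const _) hc]
  congr 1
  have : (charFun m t).re = ∫ z, (Complex.exp (t * z * Complex.I)).re ∂m := by
    rw [charFun_apply_real]; exact (integral_re (integrable_cexp_mul_I m t)).symm
  rw [this]
  simp only [← Complex.ofReal_mul, Complex.exp_ofReal_mul_I_re]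
  simp

theorem re_one_sub_smul_ge {s : ℝ} (hs0 : 0 ≤ s) {z : ℂ} (hz : ‖z‖ ≤ 1) :
    1 - s ≤ (1 - (s : ℂ) * z).re := by
  have h := (Complex.re_le_norm z).trans hz
  simp only [Complex.sub_re, Complex.one_re, Complex.re_ofReal_mul]
  nlinarith

theorem re_inv_one_sub_nonneg {s : ℝ} (hs0 : 0 ≤ s) (hs1 : s ≤ 1) {z : ℂ} (hz : ‖z‖ ≤ 1) :
    0 ≤ ((1 - (s : ℂ) * z)⁻¹).re := by
  rw [Complex.inv_re]
  exact div_nonneg ((sub_nonneg.2 hs1).trans (re_one_sub_smul_ge hs0 hz)) (Complex.normSq_nonneg _)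

/-- Split the numerator of `Re w⁻¹ = Re w / |w|²` as `(1 - s) + s (1 - Re z)`. With `q` proportional
to `|t|`, the first part becomes a Poisson kernel and the second is integrable in `t`. The bound `s
≥ 1 / 2` ensures `|s Im z| ≥ q`. -/
theorem re_inv_one_sub_le_of_im {s q : ℝ} (hs0 : 1 / 2 ≤ s) (hs1 : s < 1) {z : ℂ}
    (hz : ‖z‖ ≤ 1) (hq : 0 < q) (him : 2 * q ≤ |z.im|) :
    ((1 - (s : ℂ) * z)⁻¹).re ≤ (1 - s) / ((1 - s) ^ 2 + q ^ 2) + (1 - z.re) / q ^ 2 := by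
  have h1 := re_one_sub_smul_ge (by linarith : 0 ≤ s) hz
  have hre := (Complex.re_le_norm z).trans hz
  have hn : Complex.normSq (1 - (s : ℂ) * z) = (1 - (s : ℂ) * z).re ^ 2 + (s * z.im) ^ 2 := by
    rw [Complex.normSq_apply]
    simp only [Complex.sub_im, Complex.one_im, Complex.im_ofReal_mul]; ring
  have hi : q ^ 2 ≤ (s * z.im) ^ 2 := by
    rw [← sq_abs (s * z.im), abs_mul, abs_of_nonneg (by linarith : 0 ≤ s)]
    exact pow_le_pow_left₀ hq.le (by nlinarith) 2
  have h2 : (1 - s) ^ 2 ≤ (1 - (s : ℂ) * z).re ^ 2 := pow_le_pow_left₀ (by linarith) h1 2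
  have hsplit : (1 - (s : ℂ) * z).re = (1 - s) + s * (1 - z.re) := by
    simp only [Complex.sub_re, Complex.one_re, Complex.re_ofReal_mul]; ring
  rw [Complex.inv_re, hn]
  nth_rewrite 1 [hsplit]
  rw [add_div]
  have h3 : 0 < (1 - s) ^ 2 := by have : 0 < 1 - s := by linarith
                                  positivity
  have h4 : 0 < q ^ 2 := by positivity
  refine add_le_add ?_ ?_
  · exact div_le_div_of_nonneg_left (by linarith) (by positivity) (by linarith)
  · exact div_le_div₀ (by linarith) (by nlinarith) h4 (by nlinarith)

theorem re_inv_one_sub_le_of_norm {s κ : ℝ} (hs0 : 0 ≤ s) (hs1 : s ≤ 1) {z : ℂ}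
    (hκ : 0 < κ) (hz : ‖z‖ ≤ 1 - κ) : ((1 - (s : ℂ) * z)⁻¹).re ≤ 1 / κ := by
  refine (Complex.re_le_norm _).trans ?_
  rw [norm_inv, ← one_div]
  refine one_div_le_one_div_of_le hκ ?_
  have h1 : ‖(1 : ℂ)‖ - ‖(s : ℂ) * z‖ ≤ ‖1 - (s : ℂ) * z‖ := norm_sub_norm_le _ _
  rw [norm_mul, Complex.norm_real, Real.norm_of_nonneg hs0, norm_one] at h1
  nlinarith [norm_nonneg z]

theorem integrable_and_integral_poisson {a b : ℝ} (ha : 0 < a) (hb : 0 < b) :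
    Integrable (fun t : ℝ => a / (a ^ 2 + (b * t) ^ 2)) ∧
      ∫ t : ℝ, a / (a ^ 2 + (b * t) ^ 2) = Real.pi / b := by
  have e : (fun t : ℝ => a / (a ^ 2 + (b * t) ^ 2)) =
      fun t => a⁻¹ * (1 + (t * (b / a)) ^ 2)⁻¹ := by
    ext t
    have : 0 < a ^ 2 + (b * t) ^ 2 := by positivity
    have : 0 < 1 + (t * (b / a)) ^ 2 := by positivity
    field_simp
  rw [e]
  refine ⟨(integrable_inv_one_add_sq.comp_mul_right' (by positivity)).const_mul _, ?_⟩
  rw [integral_const_mul, Measure.integral_comp_mul_right (fun u : ℝ => (1 + u ^ 2)⁻¹),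
      integral_univ_inv_one_add_sq, smul_eq_mul, abs_of_pos (by positivity)]
  field_simp

/-- The majorant depends on `s`, but its integral does not: the Poisson kernel concentrates as `s →
1` with constant mass. -/
theorem exists_integrable_bound_re_inv (m : Measure ℝ) [IsProbabilityMeasure m]
    (hint : Integrable id m) (hmean : ∫ z, z ∂m ≠ 0)
    (hsep : ∀ δ > 0, ∃ κ > 0, ∀ t, δ ≤ |t| → ‖charFun m t‖ ≤ 1 - κ) :
    ∃ D : ℝ, ∀ s : ℝ, 1 / 2 ≤ s → s < 1 → ∃ g : ℝ → ℝ, Integrable g ∧ ∫ t, g t ≤ D ∧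
      ∀ t ≠ 0, Real.exp (-(t ^ 2 / 2)) * ((1 - (s : ℂ) * charFun m t)⁻¹).re ≤ g t := by
  obtain ⟨c, hc, δ, hδ, him⟩ := exists_mul_abs_le_abs_im_charFun m hint hmean
  obtain ⟨κ, hκ, hκb⟩ := hsep δ hδ
  have hcos := integrable_one_sub_re_charFun_div_sq m hint
  have hgauss : Integrable fun t : ℝ => Real.exp (-(t ^ 2 / 2)) := by
    convert integrable_exp_neg_mul_sq (half_pos (one_pos (α := ℝ))) using 2 with t
    congr 1; ring
  refine ⟨(∫ t : ℝ, Real.exp (-(t ^ 2 / 2)) * (1 / κ)) + Real.pi / (c / 2)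
    + ∫ t : ℝ, (1 - (charFun m t).re) / t ^ 2 * (1 / (c / 2) ^ 2), fun s hs0 hs1 => ?_⟩
  obtain ⟨hp1, hp2⟩ := integrable_and_integral_poisson (a := 1 - s) (b := c / 2)
    (by linarith) (by positivity)
  refine ⟨fun t => Real.exp (-(t ^ 2 / 2)) * (1 / κ) + (1 - s) / ((1 - s) ^ 2 + (c / 2 * t) ^ 2)
    + (1 - (charFun m t).re) / t ^ 2 * (1 / (c / 2) ^ 2),
    ((hgauss.mul_const _).add hp1).add (hcos.mul_const _), ?_, fun t ht => ?_⟩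
  · have h12 : Integrable fun t : ℝ => Real.exp (-(t ^ 2 / 2)) * (1 / κ) +
        (1 - s) / ((1 - s) ^ 2 + (c / 2 * t) ^ 2) := (hgauss.mul_const _).add hp1
    rw [integral_add h12 (hcos.mul_const _), integral_add (hgauss.mul_const _) hp1, hp2]
  · have hn : ‖charFun m t‖ ≤ 1 := norm_charFun_le_one t
    have hr0 : 0 ≤ 1 - (charFun m t).re := by linarith [(Complex.re_le_norm _).trans hn]
    have hs' : 0 ≤ 1 - s := by linarith
    have hw0 := re_inv_one_sub_nonneg (by linarith) hs1.le hn
    have ha : 0 ≤ (1 - s) / ((1 - s) ^ 2 + (c / 2 * t) ^ 2) := by positivity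
    have hb : 0 ≤ (1 - (charFun m t).re) / t ^ 2 * (1 / (c / 2) ^ 2) := by positivity
    have he : 0 ≤ Real.exp (-(t ^ 2 / 2)) * (1 / κ) := by positivity
    have he1 : Real.exp (-(t ^ 2 / 2)) ≤ 1 := Real.exp_le_one_iff.2 (by
      have := sq_nonneg t; linarith)
    rcases le_total δ |t| with h | h
    · have := mul_le_mul_of_nonneg_left
        (re_inv_one_sub_le_of_norm (s := s) (by linarith) hs1.le hκ (hκb t h))
        (Real.exp_nonneg (-(t ^ 2 / 2)))
      linarith
    · have h1 := re_inv_one_sub_le_of_im hs0 hs1 hn (q := c / 2 * |t|)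
        (by have := abs_pos.2 ht; positivity) (by linarith [him t h])
      rw [mul_pow, sq_abs, ← mul_pow] at h1
      have h2 : (1 - (charFun m t).re) / (c / 2 * t) ^ 2 =
        (1 - (charFun m t).re) / t ^ 2 * (1 / (c / 2) ^ 2) := by field_simp
      rw [h2] at h1
      have := mul_le_of_le_one_left hw0 he1
      linarith

/-- Pairing the bumps at `x` and `-x` cancels the imaginary part of the characteristic function.
This matters because only the real part of `(1 - s φ)⁻¹` is controlled near 0. -/
theorem integral_gaussian_add_integral_gaussian_neg (ν : Measure ℝ) [IsProbabilityMeasure ν]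
    (x : ℝ) :
    (∫ y, Real.exp (-((y - x) ^ 2 / 2)) ∂ν) + (∫ y, Real.exp (-((y - -x) ^ 2 / 2)) ∂ν) =
      (1 / √(2 * Real.pi)) * ∫ t : ℝ, Real.exp (-(t ^ 2 / 2)) *
        (2 * Real.cos (t * x) * (charFun ν t).re) := by
  have hgauss : Integrable fun t : ℝ => Real.exp (-(t ^ 2 / 2)) := by
    convert integrable_exp_neg_mul_sq (half_pos (one_pos (α := ℝ))) using 2 with t
    congr 1; ring
  have hG : ∀ x : ℝ, Integrable fun t : ℝ => (Real.exp (-(t ^ 2 / 2)) : ℂ) *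
      (Complex.exp (-(t * x) * Complex.I) * charFun ν t) := fun x => by
    refine hgauss.mono' (by fun_prop) (ae_of_all _ fun t => ?_)
    rw [norm_mul, norm_mul, ← Complex.ofReal_mul, ← Complex.ofReal_neg,
      Complex.norm_exp_ofReal_mul_I, one_mul, Complex.norm_real,
      Real.norm_of_nonneg (Real.exp_nonneg _)]
    exact mul_le_of_le_one_right (Real.exp_nonneg _) (norm_charFun_le_one t)
  have hre : ∀ x : ℝ, ∫ y, Real.exp (-((y - x) ^ 2 / 2)) ∂ν =
      (1 / √(2 * Real.pi)) * ∫ t : ℝ, ((Real.exp (-(t ^ 2 / 2)) : ℂ) *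
      (Complex.exp (-(t * x) * Complex.I) * charFun ν t)).re := fun x => by
    have h := congrArg Complex.re (integral_gaussian_eq_integral_charFun ν one_pos x)
    rw [Complex.ofReal_re, Complex.re_ofReal_mul] at h
    simp only [one_pow, mul_one, one_mul] at h
    rw [h]
    congr 1
    exact (integral_re (hG x)).symm
  have hGr : ∀ x : ℝ, Integrable fun t : ℝ => ((Real.exp (-(t ^ 2 / 2)) : ℂ) *
      (Complex.exp (-(t * x) * Complex.I) * charFun ν t)).re := fun x => (hG x).re
  rw [hre, hre, ← mul_add, ← integral_add (hGr x) (hGr (-x))]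
  congr 2; ext t
  rw [Complex.re_ofReal_mul, Complex.re_ofReal_mul, ← mul_add]
  congr 1
  simp only [← Complex.ofReal_mul, ← Complex.ofReal_neg, Complex.mul_re,
    Complex.exp_ofReal_mul_I_re, Complex.exp_ofReal_mul_I_im, mul_neg, neg_neg, Real.cos_neg,
    Real.sin_neg]
  ring

/-- Transience: the renewal measure integrates Gaussian bumps of unit width uniformly. -/
theorem exists_sum_integral_gaussian_le (m : Measure ℝ) [IsProbabilityMeasure m]
    (hint : Integrable id m) (hmean : ∫ z, z ∂m ≠ 0)
    (hsep : ∀ δ > 0, ∃ κ > 0, ∀ t, δ ≤ |t| → ‖charFun m t‖ ≤ 1 - κ)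
    (ν : ℕ → Measure ℝ) [∀ n, IsProbabilityMeasure (ν n)]
    (hν : ∀ n t, charFun (ν n) t = charFun m t ^ n) :
    ∃ U : ℝ, ∀ (x : ℝ) (M : ℕ),
      ∑ n ∈ Finset.range M, ∫ y, Real.exp (-((y - x) ^ 2 / 2)) ∂ν n ≤ U := by
  obtain ⟨D, hD⟩ := exists_integrable_bound_re_inv m hint hmean hsep
  have hgauss : Integrable fun t : ℝ => Real.exp (-(t ^ 2 / 2)) := by
    convert integrable_exp_neg_mul_sq (half_pos (one_pos (α := ℝ))) using 2 with t
    congr 1; ring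
  set K : ℝ := 1 / √(2 * Real.pi)
  have hK : 0 < K := by positivity
  refine ⟨K * (2 * D), fun x M => ?_⟩
  set a : ℕ → ℝ → ℝ := fun n x => ∫ y, Real.exp (-((y - x) ^ 2 / 2)) ∂ν n
  have ha0 : ∀ n x, 0 ≤ a n x := fun n x => integral_nonneg fun y => Real.exp_nonneg _
  -- The weights `s ^ n` make the series converge absolutely; the bound is uniform in `s`, and `s →
  -- 1` is harmless in a finite sum.
  have abel : ∀ s : ℝ, 1 / 2 ≤ s → s < 1 →
      ∑ n ∈ Finset.range M, s ^ n * a n x ≤ K * (2 * D) := by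
    intro s hs0 hs1
    have hs : 0 ≤ s := by linarith
    obtain ⟨g, hgi, hgD, hg⟩ := hD s hs0 hs1
    set F : ℕ → ℝ → ℝ := fun n t => Real.exp (-(t ^ 2 / 2)) *
      (2 * Real.cos (t * x) * (((s : ℂ) * charFun m t) ^ n).re)
    have hzn : ∀ t, ‖(s : ℂ) * charFun m t‖ ≤ s := fun t => by
      rw [norm_mul, Complex.norm_real, Real.norm_of_nonneg hs]
      exact mul_le_of_le_one_right hs (norm_charFun_le_one t)
    have hFb : ∀ n t, ‖F n t‖ ≤ s ^ n * (2 * Real.exp (-(t ^ 2 / 2))) := fun n t => by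
      have h1 : |(((s : ℂ) * charFun m t) ^ n).re| ≤ s ^ n := by
        refine (Complex.abs_re_le_norm _).trans ?_
        rw [norm_pow]; exact pow_le_pow_left₀ (norm_nonneg _) (hzn t) n
      have h2 := mul_le_mul (Real.abs_cos_le_one (t * x)) h1 (abs_nonneg _) zero_le_one
      rw [Real.norm_eq_abs, abs_mul, abs_mul, abs_mul, abs_two, abs_of_pos (Real.exp_pos _)]
      nlinarith [Real.exp_pos (-(t ^ 2 / 2))]
    have hgn : ∀ n : ℕ, Integrable fun t : ℝ => s ^ n * (2 * Real.exp (-(t ^ 2 / 2))) :=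
      fun n => (hgauss.const_mul 2).const_mul _
    have hFi : ∀ n, Integrable (F n) := fun n =>
      (hgn n).mono' (Continuous.aestronglyMeasurable (by
        have : Continuous (charFun m) := continuous_charFun
        fun_prop)) (ae_of_all _ (hFb n))
    have hsum : Summable fun n => ∫ t, ‖F n t‖ := by
      refine Summable.of_nonneg_of_le (fun n => integral_nonneg fun t => norm_nonneg _)
        (fun n => (integral_mono (hFi n).norm (hgn n) (hFb n)).trans_eq (integral_const_mul _ _))
        ((summable_geometric_of_lt_one hs hs1).mul_right _)
    have hS := hasSum_integral_of_summable_integral_norm hFi hsum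
    have hts : ∀ t, ∑' n, F n t = Real.exp (-(t ^ 2 / 2)) *
        (2 * Real.cos (t * x) * ((1 - (s : ℂ) * charFun m t)⁻¹).re) := fun t => by
      have h1 := hasSum_geometric_of_norm_lt_one ((hzn t).trans_lt hs1)
      exact ((((Complex.hasSum_re h1).mul_left _).mul_left _).tsum_eq)
    simp only [hts] at hS
    have hFa : ∀ n, K * ∫ t, F n t = s ^ n * (a n x + a n (-x)) := fun n => by
      simp only [a]
      rw [integral_gaussian_add_integral_gaussian_neg, mul_left_comm (s ^ n), ← integral_const_mul (s ^ n)]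
      congr 2; ext t
      simp only [F]
      rw [hν, mul_pow, ← Complex.ofReal_pow, Complex.re_ofReal_mul]
      ring
    have hle : ‖∫ t : ℝ, Real.exp (-(t ^ 2 / 2)) *
        (2 * Real.cos (t * x) * ((1 - (s : ℂ) * charFun m t)⁻¹).re)‖ ≤ ∫ t, 2 * g t := by
      refine norm_integral_le_of_norm_le (hgi.const_mul 2) ?_
      filter_upwards [Measure.ae_ne volume (0 : ℝ)] with t ht
      have h0 := re_inv_one_sub_nonneg hs hs1.le (norm_charFun_le_one (μ := m) t)
      have h1 := mul_le_of_le_one_left h0 (Real.abs_cos_le_one (t * x))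
      have h2 := hg t ht
      rw [Real.norm_eq_abs, abs_mul, abs_mul, abs_mul, abs_two, abs_of_pos (Real.exp_pos _),
        abs_of_nonneg h0]
      nlinarith [Real.exp_pos (-(t ^ 2 / 2))]
    rw [integral_const_mul] at hle
    have h3 : ∑ n ∈ Finset.range M, s ^ n * (a n x + a n (-x)) ≤
        K * ∫ t : ℝ, Real.exp (-(t ^ 2 / 2)) *
        (2 * Real.cos (t * x) * ((1 - (s : ℂ) * charFun m t)⁻¹).re) := by
      have hS' : HasSum (fun n => s ^ n * (a n x + a n (-x))) (K * ∫ t : ℝ,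
          Real.exp (-(t ^ 2 / 2)) *
            (2 * Real.cos (t * x) * ((1 - (s : ℂ) * charFun m t)⁻¹).re)) := by
        simp only [← hFa]
        exact hS.mul_left K
      exact sum_le_hasSum (Finset.range M) (fun n _ => mul_nonneg (pow_nonneg hs n)
        (add_nonneg (ha0 _ _) (ha0 _ _))) hS'
    have h4 : ∑ n ∈ Finset.range M, s ^ n * a n x ≤
        ∑ n ∈ Finset.range M, s ^ n * (a n x + a n (-x)) :=
      Finset.sum_le_sum fun n _ => mul_le_mul_of_nonneg_left (by linarith [ha0 n (-x)])
        (pow_nonneg hs n)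
    refine h4.trans (h3.trans (mul_le_mul_of_nonneg_left ?_ hK.le))
    exact (le_abs_self _).trans (hle.trans (by linarith))
  have hcont : Tendsto (fun s : ℝ => ∑ n ∈ Finset.range M, s ^ n * a n x) (𝓝[<] 1)
      (𝓝 (∑ n ∈ Finset.range M, (1 : ℝ) ^ n * a n x)) :=
    (Continuous.tendsto (f := fun s : ℝ => ∑ n ∈ Finset.range M, s ^ n * a n x)
      (by fun_prop) 1).mono_left nhdsWithin_le_nhds
  simp only [one_pow, one_mul] at hcont
  refine le_of_tendsto hcont ?_
  filter_upwards [Ioo_mem_nhdsLT (show (1 / 2 : ℝ) < 1 by norm_num)] with s hs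
  exact abel s hs.1.le hs.2

/-! ### Large `n`: narrow against wide Gaussians -/

theorem geom_sum_Ico_mul_one_sub_le {q : ℝ} (hq : 0 ≤ q) (N M : ℕ) :
    (∑ n ∈ Finset.Ico N M, q ^ n) * (1 - q) ≤ q ^ N := by
  rcases le_total N M with h | h
  · rw [geom_sum_Ico_mul_neg q h]; linarith [pow_nonneg hq M]
  · rw [Finset.Ico_eq_empty_of_le h]; simp; positivity

theorem exists_sum_Ico_gaussian_sub_le (m : Measure ℝ) [IsProbabilityMeasure m]
    {ρ T κ : ℝ} (hρ0 : 0 ≤ ρ) (hρ : ρ < 1) (hT : 0 < T) (hκ : 0 < κ)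
    (hout : ∀ t, T ≤ |t| → ‖charFun m t‖ ≤ ρ)
    (hin : ∀ t, |t| ≤ T → κ * t ^ 2 ≤ 1 - ‖charFun m t‖)
    (ν : ℕ → Measure ℝ) [∀ n, IsProbabilityMeasure (ν n)]
    (hν : ∀ n t, charFun (ν n) t = charFun m t ^ n) :
    ∃ C : ℝ, 0 ≤ C ∧ ∀ h : ℝ, 0 < h → h ≤ 1 → ∀ (x : ℝ) (N M : ℕ),
      ∑ n ∈ Finset.Ico N M, ((∫ y, Real.exp (-((y - x) ^ 2 / (2 * h ^ 2))) ∂ν n) -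
        h * ∫ y, Real.exp (-((y - x) ^ 2 / 2)) ∂ν n) ≤ C * (h + ρ ^ N) := by
  have hg : ∀ h : ℝ, 0 < h → Integrable fun t : ℝ => Real.exp (-(h ^ 2 * t ^ 2 / 2)) := by
    intro h hh
    convert integrable_exp_neg_mul_sq (b := h ^ 2 / 2) (by positivity) using 2 with t
    congr 1; ring_nf
  set W : ℝ := √(2 * Real.pi) with hW
  have hW0 : 0 < W := by positivity
  have hρ1 : 0 < 1 - ρ := by linarith
  refine ⟨T / κ / W + 1 / (1 - ρ), by positivity, fun h hh hh1 x N M => ?_⟩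
  have hgv : ∫ t : ℝ, Real.exp (-(h ^ 2 * t ^ 2 / 2)) = W / h := by
    have := integral_gaussian (h ^ 2 / 2)
    rw [show Real.pi / (h ^ 2 / 2) = 2 * Real.pi / h ^ 2 by field_simp,
      Real.sqrt_div (by positivity), Real.sqrt_sq hh.le] at this
    rw [← this]; congr 1; ext t; congr 1; ring
  set d : ℝ → ℝ := fun t => Real.exp (-(h ^ 2 * t ^ 2 / 2)) - Real.exp (-(t ^ 2 / 2)) with hd
  have hd0 : ∀ t, 0 ≤ d t := fun t => sub_nonneg.2 (Real.exp_le_exp.2 (by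
    have : h ^ 2 * t ^ 2 ≤ 1 * t ^ 2 :=
      mul_le_mul_of_nonneg_right (by nlinarith) (sq_nonneg t)
    linarith))
  -- This quadratic vanishing is why a multiple of the wide Gaussian is subtracted: it offsets `1 /
  -- (κ t²)` from the geometric sum.
  have hd1 : ∀ t, d t ≤ t ^ 2 / 2 := fun t => by
    have h1 : Real.exp (-(h ^ 2 * t ^ 2 / 2)) ≤ 1 := Real.exp_le_one_iff.2 (by
      have : 0 ≤ h ^ 2 * t ^ 2 := by positivity
      linarith)
    have h2 := Real.add_one_le_exp (-(t ^ 2 / 2))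
    simp only [hd]; linarith
  have hd2 : ∀ t, d t ≤ Real.exp (-(h ^ 2 * t ^ 2 / 2)) := fun t =>
    sub_le_self _ (Real.exp_nonneg _)
  have hdi : Integrable d := (hg h hh).sub (by simpa using hg 1 one_pos)
  have hcont : Continuous (charFun m) := continuous_charFun
  have hq1 : ∀ t, ‖charFun m t‖ ≤ 1 := norm_charFun_le_one
  have hdq : ∀ n : ℕ, Integrable fun t => d t * ‖charFun m t‖ ^ n := fun n => by
    refine hdi.mono' (Continuous.aestronglyMeasurable (by fun_prop)) (ae_of_all _ fun t => ?_)
    rw [Real.norm_of_nonneg (mul_nonneg (hd0 t) (by positivity))]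
    exact mul_le_of_le_one_right (hd0 t) (pow_le_one₀ (norm_nonneg _) (hq1 t))
  have hterm : ∀ n : ℕ, (∫ y, Real.exp (-((y - x) ^ 2 / (2 * h ^ 2))) ∂ν n) -
      h * ∫ y, Real.exp (-((y - x) ^ 2 / 2)) ∂ν n ≤ h / W * ∫ t, d t * ‖charFun m t‖ ^ n := by
    intro n
    have e1 := integral_gaussian_eq_integral_charFun (ν n) hh x
    have e2 := integral_gaussian_eq_integral_charFun (ν n) one_pos x
    simp only [one_pow, mul_one, one_mul] at e2
    have hb : ∀ k : ℝ, 0 < k → Integrable fun t : ℝ => (Real.exp (-(k ^ 2 * t ^ 2 / 2)) : ℂ) *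
        (Complex.exp (-(t * x) * Complex.I) * charFun (ν n) t) := fun k hk => by
      refine (hg k hk).mono' (by fun_prop) (ae_of_all _ fun t => ?_)
      rw [norm_mul, norm_mul, ← Complex.ofReal_mul, ← Complex.ofReal_neg,
        Complex.norm_exp_ofReal_mul_I, one_mul, Complex.norm_real,
        Real.norm_of_nonneg (Real.exp_nonneg _)]
      exact mul_le_of_le_one_right (Real.exp_nonneg _) (norm_charFun_le_one t)
    have hb1 := hb 1 one_pos
    simp only [one_pow, one_mul] at hb1
    set A := ∫ y, Real.exp (-((y - x) ^ 2 / (2 * h ^ 2))) ∂ν n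
    set B := ∫ y, Real.exp (-((y - x) ^ 2 / 2)) ∂ν n
    have e3 : ((A - h * B : ℝ) : ℂ) = (h / W : ℝ) * ∫ t : ℝ, (d t : ℂ) *
        (Complex.exp (-(t * x) * Complex.I) * charFun (ν n) t) := by
      have : ∀ t : ℝ, (d t : ℂ) * (Complex.exp (-(t * x) * Complex.I) * charFun (ν n) t) =
          (Real.exp (-(h ^ 2 * t ^ 2 / 2)) : ℂ) *
            (Complex.exp (-(t * x) * Complex.I) * charFun (ν n) t) -
          (Real.exp (-(t ^ 2 / 2)) : ℂ) *
            (Complex.exp (-(t * x) * Complex.I) * charFun (ν n) t) := fun t => by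
        simp only [hd, Complex.ofReal_sub]; ring
      simp only [this]
      rw [integral_sub (hb h hh) hb1, mul_sub, ← e1, Complex.ofReal_sub, Complex.ofReal_mul, e2]
      push_cast; ring
    calc A - h * B ≤ ‖((A - h * B : ℝ) : ℂ)‖ := by
          rw [Complex.norm_real]; exact le_abs_self _
      _ ≤ _ := by
          rw [e3, norm_mul, Complex.norm_real, Real.norm_of_nonneg (by positivity)]
          refine mul_le_mul_of_nonneg_left ?_ (by positivity)
          refine norm_integral_le_of_norm_le (hdq n) (ae_of_all _ fun t => le_of_eq ?_)
          rw [norm_mul, norm_mul, ← Complex.ofReal_mul, ← Complex.ofReal_neg,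
            Complex.norm_exp_ofReal_mul_I, one_mul, Complex.norm_real,
            Real.norm_of_nonneg (hd0 t), hν, norm_pow]
  have hIi : Integrable ((Icc (-T) T).indicator fun _ : ℝ => 1 / (2 * κ)) :=
    (integrable_indicator_iff measurableSet_Icc).2 (integrableOn_const (by simp))
  have hIv : ∫ t, (Icc (-T) T).indicator (fun _ : ℝ => 1 / (2 * κ)) t = T / κ := by
    rw [integral_indicator measurableSet_Icc, setIntegral_const, smul_eq_mul,
      Real.volume_real_Icc_of_le (by linarith)]
    field_simp
    ring_nf
  -- The indicator handles `|t| ≤ T`. Outside, the Gaussian has mass `W / h`, which the prefactor `h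
  -- / W` cancels, leaving `ρ ^ N / (1 - ρ)`.
  have hpt : ∀ t, d t * ∑ n ∈ Finset.Ico N M, ‖charFun m t‖ ^ n ≤
      (Icc (-T) T).indicator (fun _ : ℝ => 1 / (2 * κ)) t +
        ρ ^ N / (1 - ρ) * Real.exp (-(h ^ 2 * t ^ 2 / 2)) := by
    intro t
    have hS0 : 0 ≤ ∑ n ∈ Finset.Ico N M, ‖charFun m t‖ ^ n :=
      Finset.sum_nonneg fun n _ => by positivity
    have hE : 0 ≤ ρ ^ N / (1 - ρ) * Real.exp (-(h ^ 2 * t ^ 2 / 2)) := by positivity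
    rcases le_total |t| T with ht | ht
    · rw [indicator_of_mem (show t ∈ Icc (-T) T from abs_le.1 ht)]
      have h1 := geom_sum_Ico_mul_one_sub_le (norm_nonneg (charFun m t)) N M
      have h2 := pow_le_one₀ (n := N) (norm_nonneg _) (hq1 t)
      have h3 := mul_le_mul_of_nonneg_left (hin t ht) hS0
      have h4 := mul_le_mul_of_nonneg_right (hd1 t) hS0
      have h5 : t ^ 2 / 2 * ∑ n ∈ Finset.Ico N M, ‖charFun m t‖ ^ n ≤ 1 / (2 * κ) := by
        rw [le_div_iff₀ (by positivity)]; linarith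
      linarith
    · have h1 : ∑ n ∈ Finset.Ico N M, ‖charFun m t‖ ^ n ≤ ρ ^ N / (1 - ρ) := by
        rw [le_div_iff₀ hρ1]
        refine le_trans (mul_le_mul_of_nonneg_right (Finset.sum_le_sum fun n _ =>
          pow_le_pow_left₀ (norm_nonneg _) (hout t ht) n) hρ1.le)
          (geom_sum_Ico_mul_one_sub_le hρ0 N M)
      have h2 := mul_le_mul (hd2 t) h1 hS0 (Real.exp_nonneg _)
      have h3 : 0 ≤ (Icc (-T) T).indicator (fun _ : ℝ => 1 / (2 * κ)) t :=
        indicator_nonneg (fun _ _ => by positivity) t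
      linarith
  have hsum := Finset.sum_le_sum (s := Finset.Ico N M) fun n _ => hterm n
  rw [← Finset.mul_sum, ← integral_finsetSum _ fun n _ => hdq n] at hsum
  simp only [← Finset.mul_sum] at hsum
  have hint : ∫ t, d t * ∑ n ∈ Finset.Ico N M, ‖charFun m t‖ ^ n ≤
      T / κ + ρ ^ N / (1 - ρ) * (W / h) := by
    rw [← hIv, ← hgv, ← integral_const_mul, ← integral_add hIi ((hg h hh).const_mul _)]
    refine integral_mono_of_nonneg (ae_of_all _ fun t => mul_nonneg (hd0 t)
      (Finset.sum_nonneg fun n _ => by positivity)) (hIi.add ((hg h hh).const_mul _))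
      (ae_of_all _ hpt)
  refine hsum.trans ((mul_le_mul_of_nonneg_left hint (by positivity)).trans ?_)
  have e : h / W * (T / κ + ρ ^ N / (1 - ρ) * (W / h)) =
      T / κ / W * h + 1 / (1 - ρ) * ρ ^ N := by field_simp
  rw [e]
  have h1 : 0 ≤ T / κ / W * ρ ^ N := by positivity
  have h2 : 0 ≤ 1 / (1 - ρ) * h := by positivity
  nlinarith

/-! ### The walk, small `n`, and the hypotheses in usable form -/

theorem aemeasurable_walk {Ω : Type*} [MeasurableSpace Ω] {P : Measure Ω} {Y : ℕ → Ω → ℝ}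
    (hY : ∀ k, AEMeasurable (Y k) P) (n : ℕ) : AEMeasurable (walk Y n) P := by
  unfold walk
  exact Finset.aemeasurable_fun_sum _ fun k _ => hY k

theorem charFun_map_walk {Ω : Type*} [MeasurableSpace Ω] {P : Measure Ω} [IsProbabilityMeasure P]
    {Z : Ω → ℝ} {Y : ℕ → Ω → ℝ} (hYindep : iIndepFun Y P)
    (hYlaw : ∀ k, IdentDistrib (Y k) Z P P) (n : ℕ) (t : ℝ) :
    charFun (P.map (walk Y n)) t = charFun (P.map Z) t ^ n := by
  have h := iIndepFun.charFun_map_fun_finsetSum_eq_prod (s := Finset.range n)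
    (fun k _ => (hYlaw k).aemeasurable_fst)
    (hYindep.precomp (g := ((↑) : Finset.range n → ℕ)) Subtype.val_injective)
  have h' := congrFun h t
  simp only [Finset.prod_apply, (hYlaw _).map_eq, Finset.prod_const, Finset.card_range] at h'
  exact h'

/-- A sum exceeding `x ≥ 0` has a positive summand; take a union bound over its index `k` and
condition on the independent sum `R` of the others. -/
theorem measure_walk_Ioc_le {Ω : Type*} [MeasurableSpace Ω] {P : Measure Ω}
    [IsProbabilityMeasure P] {Z : Ω → ℝ} {Y : ℕ → Ω → ℝ} (hYindep : iIndepFun Y P)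
    (hYlaw : ∀ k, IdentDistrib (Y k) Z P P) {x h : ℝ} (hx : 0 ≤ x) {B : ℝ≥0∞}
    (hB : ∀ a, 0 ≤ a → P {ω | a < Z ω ∧ Z ω ≤ a + h} ≤ B) (n : ℕ) :
    P.map (walk Y n) (Ioc x (x + h)) ≤ n * B := by
  have hY := fun k => (hYlaw k).aemeasurable_fst
  have hZ := (hYlaw 0).aemeasurable_snd
  rw [Measure.map_apply_of_aemeasurable (aemeasurable_walk hY n) measurableSet_Ioc]
  have hsub : walk Y n ⁻¹' Ioc x (x + h) ⊆
      ⋃ k ∈ Finset.range n, {ω | walk Y n ω ∈ Ioc x (x + h) ∧ 0 < Y k ω} := by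
    intro ω hω
    have hpos : 0 < ∑ k ∈ Finset.range n, Y k ω := hx.trans_lt hω.1
    obtain ⟨k, hk, hk0⟩ : ∃ k ∈ Finset.range n, 0 < Y k ω := by
      by_contra! hcon
      exact absurd hpos (not_lt.2 (Finset.sum_nonpos hcon))
    exact mem_biUnion hk ⟨hω, hk0⟩
  refine (measure_mono hsub).trans ((measure_biUnion_finset_le _ _).trans ?_)
  have hk : ∀ k ∈ Finset.range n, P {ω | walk Y n ω ∈ Ioc x (x + h) ∧ 0 < Y k ω} ≤ B := by
    intro k hk
    set R : Ω → ℝ := ∑ j ∈ (Finset.range n).erase k, Y j with hR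
    have hRm : AEMeasurable R P := Finset.aemeasurable_sum _ fun j _ => hY j
    have hind : IndepFun R (Y k) P :=
      hYindep.indepFun_finsetSum_of_notMem₀ hY (Finset.notMem_erase k _)
    have hprod := (indepFun_iff_map_prod_eq_prod_map_map hRm (hY k)).1 hind
    have hset : MeasurableSet {p : ℝ × ℝ | p.1 + p.2 ∈ Ioc x (x + h) ∧ 0 < p.2} :=
      ((measurable_fst.add measurable_snd) measurableSet_Ioc).inter
        (measurable_snd measurableSet_Ioi)
    have heq : {ω | walk Y n ω ∈ Ioc x (x + h) ∧ 0 < Y k ω} =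
        (fun ω => (R ω, Y k ω)) ⁻¹' {p : ℝ × ℝ | p.1 + p.2 ∈ Ioc x (x + h) ∧ 0 < p.2} := by
      ext ω
      have : walk Y n ω = R ω + Y k ω := by
        rw [hR, Finset.sum_apply, walk, Finset.sum_erase_add _ _ hk]
      simp only [mem_ofPred_eq, mem_preimage, this]
    have : IsProbabilityMeasure (P.map R) := Measure.isProbabilityMeasure_map hRm
    have : IsProbabilityMeasure (P.map Z) := Measure.isProbabilityMeasure_map hZ
    rw [heq, ← Measure.map_apply_of_aemeasurable (hRm.prodMk (hY k)) hset, hprod,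
      (hYlaw k).map_eq, Measure.prod_apply hset]
    calc ∫⁻ r, P.map Z (Prod.mk r ⁻¹' {p : ℝ × ℝ | p.1 + p.2 ∈ Ioc x (x + h) ∧ 0 < p.2})
          ∂(P.map R) ≤ ∫⁻ _, B ∂(P.map R) := by
          refine lintegral_mono fun r => ?_
          -- Positivity of the step lets the left endpoint be raised to 0, where `hB` applies.
          have hs : Prod.mk r ⁻¹' {p : ℝ × ℝ | p.1 + p.2 ∈ Ioc x (x + h) ∧ 0 < p.2} ⊆
              Ioc (max (x - r) 0) (max (x - r) 0 + h) := by
            rintro y ⟨⟨h1, h2⟩, h3⟩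
            simp only at h1 h2 h3
            exact ⟨max_lt (by linarith) h3, by linarith [le_max_left (x - r) 0]⟩
          refine (measure_mono hs).trans ?_
          rw [Measure.map_apply_of_aemeasurable hZ measurableSet_Ioc]
          exact hB _ (le_max_right _ _)
      _ = B := by simp
  refine (Finset.sum_le_card_nsmul _ _ _ hk).trans ?_
  simp

theorem measureReal_Ioc_le_integral_gaussian (ν : Measure ℝ) [IsFiniteMeasure ν] {h : ℝ}
    (hh : 0 < h) (x : ℝ) :
    ν.real (Ioc x (x + h)) ≤
      Real.exp (1 / 2) * ∫ y, Real.exp (-((y - x) ^ 2 / (2 * h ^ 2))) ∂ν := by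
  rw [← integral_indicator_one measurableSet_Ioc, ← integral_const_mul]
  refine integral_mono_of_nonneg
    (ae_of_all _ fun y => indicator_nonneg (fun _ _ => zero_le_one) y) ?_
    (ae_of_all _ fun y => ?_)
  · refine Integrable.of_bound (C := Real.exp (1 / 2)) (by fun_prop) (ae_of_all _ fun y => ?_)
    rw [Real.norm_of_nonneg (by positivity)]
    refine mul_le_of_le_one_right (Real.exp_nonneg _) (Real.exp_le_one_iff.2 ?_)
    have : 0 ≤ (y - x) ^ 2 / (2 * h ^ 2) := by positivity
    linarith
  · by_cases hy : y ∈ Ioc x (x + h)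
    swap
    · rw [indicator_of_notMem hy]; positivity
    rw [indicator_of_mem hy, Pi.one_apply]
    simp only
    rw [← Real.exp_add]
    refine Real.one_le_exp ?_
    have h1 : (y - x) ^ 2 ≤ h ^ 2 := pow_le_pow_left₀ (by linarith [hy.1]) (by linarith [hy.2]) 2
    have : (y - x) ^ 2 / (2 * h ^ 2) ≤ 1 / 2 := by
      rw [div_le_iff₀ (by positivity)]; linarith
    linarith

theorem StronglyNonLattice.exists_norm_charFun_le {Ω : Type*} [MeasurableSpace Ω] {P : Measure Ω}
    [IsProbabilityMeasure P] {Z : Ω → ℝ} (hZ : AEMeasurable Z P) (h : StronglyNonLattice P Z) :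
    ∃ ρ : ℝ, 0 < ρ ∧ ρ < 1 ∧ ∃ T : ℝ, 0 < T ∧ ∀ t, T ≤ |t| → ‖charFun (P.map Z) t‖ ≤ ρ := by
  have : IsProbabilityMeasure (P.map Z) := Measure.isProbabilityMeasure_map hZ
  obtain ⟨ρ, h1, h2⟩ := exists_between h
  have hev := eventually_lt_of_limsup_lt h1
    (isBoundedUnder_of ⟨1, fun t => norm_charFun_le_one t⟩)
  rw [eventually_comap] at hev
  obtain ⟨T, hT⟩ := eventually_atTop.1 hev
  have hb : ∀ t, max T 1 ≤ |t| → ‖charFun (P.map Z) t‖ < ρ :=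
    fun t ht => hT _ ((le_max_left _ _).trans ht) t rfl
  refine ⟨ρ, (norm_nonneg _).trans_lt (hb (max T 1) (le_abs_self _)), h2, max T 1,
    by positivity, fun t ht => (hb t ht).le⟩

theorem exists_holder_bound {Ω : Type*} [MeasurableSpace Ω] {P : Measure Ω} {Z : Ω → ℝ} {β : ℝ}
    (hcond : limsup (fun h : ℝ => ⨆ a : ℝ, ⨆ _ : 0 ≤ a,
        ENNReal.ofReal (h ^ (-β)) * P {ω | a < Z ω ∧ Z ω ≤ a + h}) (𝓝[>] (0 : ℝ)) < ∞) :
    ∃ A : ℝ, 0 ≤ A ∧ ∃ h₀ : ℝ, 0 < h₀ ∧ ∀ h, 0 < h → h < h₀ → ∀ a, 0 ≤ a →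
      P {ω | a < Z ω ∧ Z ω ≤ a + h} ≤ ENNReal.ofReal (A * h ^ β) := by
  obtain ⟨A, hA1, hA2⟩ := exists_between hcond
  have hev := eventually_lt_of_limsup_lt hA1
  obtain ⟨h₀, hh₀, hs⟩ := mem_nhdsGT_iff_exists_Ioo_subset.1 hev
  refine ⟨A.toReal, ENNReal.toReal_nonneg, h₀, hh₀, fun h hh hlt a ha => ?_⟩
  have h1 : ENNReal.ofReal (h ^ (-β)) * P {ω | a < Z ω ∧ Z ω ≤ a + h} ≤ A :=
    le_trans (le_iSup₂ (f := fun (a : ℝ) (_ : 0 ≤ a) =>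
      ENNReal.ofReal (h ^ (-β)) * P {ω | a < Z ω ∧ Z ω ≤ a + h}) a ha) (hs ⟨hh, hlt⟩).le
  have hp : 0 < h ^ β := Real.rpow_pos_of_pos hh β
  calc P {ω | a < Z ω ∧ Z ω ≤ a + h}
      = ENNReal.ofReal (h ^ β) * (ENNReal.ofReal (h ^ (-β)) *
          P {ω | a < Z ω ∧ Z ω ≤ a + h}) := by
        rw [← mul_assoc, ← ENNReal.ofReal_mul hp.le, ← Real.rpow_add hh, add_neg_cancel,
          Real.rpow_zero, ENNReal.ofReal_one, one_mul]
    _ ≤ ENNReal.ofReal (h ^ β) * A := by gcongr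
    _ = ENNReal.ofReal (A.toReal * h ^ β) := by
        rw [ENNReal.ofReal_mul ENNReal.toReal_nonneg, ENNReal.ofReal_toReal hA2.ne, mul_comm]

/-! ### From partial sums to the renewal measure; choice of exponents -/

theorem renewalMeasure_le_ofReal {Ω : Type*} [MeasurableSpace Ω] {P : Measure Ω}
    [IsProbabilityMeasure P] {Y : ℕ → Ω → ℝ} {B : Set ℝ} (hB : MeasurableSet B) {c : ℝ}
    (h : ∀ M, ∑ n ∈ Finset.range M, (P.map (walk Y n)).real B ≤ c) :
    renewalMeasure P Y B ≤ ENNReal.ofReal c := by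
  rw [renewalMeasure, Measure.sum_apply _ hB]
  refine ENNReal.tsum_le_of_sum_range_le fun M => ?_
  refine le_trans (le_of_eq ?_) (ENNReal.ofReal_le_ofReal (h M))
  rw [ENNReal.ofReal_sum_of_nonneg fun _ _ => measureReal_nonneg]
  exact Finset.sum_congr rfl fun n _ => (ofReal_measureReal (measure_ne_top _ _)).symm

theorem renewalMeasure_Ioc_nat_le {Ω : Type*} [MeasurableSpace Ω] {P : Measure Ω}
    {Y : ℕ → Ω → ℝ} {V : ℝ≥0∞} (h : ∀ x, renewalMeasure P Y (Ioc x (x + 1)) ≤ V) (x : ℝ) (k : ℕ) :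
    renewalMeasure P Y (Ioc x (x + k)) ≤ k * V := by
  induction k with
  | zero => simp
  | succ k ih =>
    have hu : Ioc x (x + (k + 1 : ℕ)) = Ioc x (x + k) ∪ Ioc (x + k) (x + k + 1) := by
      rw [Ioc_union_Ioc_eq_Ioc (by simp) (by simp)]
      push_cast; rw [add_assoc]
    rw [hu]
    refine (measure_union_le _ _).trans ((add_le_add ih (h _)).trans_eq ?_)
    push_cast; ring

theorem toReal_renewalFunction_sub_le {Ω : Type*} [MeasurableSpace Ω] {P : Measure Ω}
    {Y : ℕ → Ω → ℝ} {x h b : ℝ} (hh : 0 ≤ h) (hb : 0 ≤ b)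
    (hle : renewalMeasure P Y (Ioc x (x + h)) ≤ ENNReal.ofReal b)
    (hfin : renewalFunction P Y (x + h) < ∞) :
    (renewalFunction P Y (x + h)).toReal - (renewalFunction P Y x).toReal ≤ b := by
  have hu : renewalFunction P Y (x + h) ≤ renewalFunction P Y x + ENNReal.ofReal b := by
    rw [renewalFunction, ← Iic_union_Ioc_eq_Iic (by linarith : x ≤ x + h)]
    exact (measure_union_le _ _).trans (add_le_add le_rfl hle)
  have hx : renewalFunction P Y x < ∞ :=
    (measure_mono (Iic_subset_Iic.2 (by linarith))).trans_lt hfin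
  have h1 := ENNReal.toReal_mono (ENNReal.add_ne_top.2 ⟨hx.ne, ENNReal.ofReal_ne_top⟩) hu
  rw [ENNReal.toReal_add hx.ne ENNReal.ofReal_ne_top, ENNReal.toReal_ofReal hb] at h1
  linarith

/-- `N ρ ^ N` is at most the geometric sum; this crude rate is all that the tail needs. -/
theorem pow_le_inv_mul_of_inv_le {ρ y : ℝ} (hρ0 : 0 ≤ ρ) (hρ : ρ < 1) (hy : 0 < y) {N : ℕ}
    (hN : y⁻¹ ≤ N) : ρ ^ N ≤ 1 / (1 - ρ) * y := by
  have hρ1 : 0 < 1 - ρ := by linarith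
  have h1 := geom_sum_Ico_mul_one_sub_le hρ0 0 N
  have h2 : (Finset.Ico 0 N).card • ρ ^ N ≤ ∑ n ∈ Finset.Ico 0 N, ρ ^ n :=
    Finset.card_nsmul_le_sum _ _ _ fun n hn =>
      pow_le_pow_of_le_one hρ0 hρ.le (Finset.mem_Ico.1 hn).2.le
  rw [Nat.card_Ico, nsmul_eq_mul, Nat.sub_zero] at h2
  have h3 : y⁻¹ * ρ ^ N * (1 - ρ) ≤ 1 := by
    refine le_trans ?_ (h1.trans_eq (pow_zero ρ))
    refine mul_le_mul_of_nonneg_right (le_trans ?_ h2) hρ1.le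
    exact mul_le_mul_of_nonneg_right hN (by positivity)
  rw [one_div_mul_eq_div, le_div_iff₀ hρ1]
  calc ρ ^ N * (1 - ρ) = y * (y⁻¹ * ρ ^ N * (1 - ρ)) := by field_simp
    _ ≤ y * 1 := by gcongr
    _ = y := mul_one y

/-- With `y = h ^ (min β 1 / 4)`, the ceiling is at most `2 / y` and `h ^ β ≤ y ^ 4`, so the quarter
in the exponent leaves two powers of `y` to spare. -/
theorem natCeil_mul_natCeil_mul_rpow_le {β h : ℝ} (hβ : 0 < β) (hh : 0 < h) (hh1 : h ≤ 1) :
    (⌈(h ^ (min β 1 / 4))⁻¹⌉₊ : ℝ) * (⌈(h ^ (min β 1 / 4))⁻¹⌉₊ * h ^ β) ≤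
      4 * (h ^ (min β 1 / 4)) ^ 2 := by
  set y := h ^ (min β 1 / 4) with hy
  have hy0 : 0 < y := Real.rpow_pos_of_pos hh _
  have hyb : h ^ β ≤ y ^ 4 := by
    rw [hy, ← Real.rpow_natCast (h ^ (min β 1 / 4)) 4, ← Real.rpow_mul hh.le]
    exact Real.rpow_le_rpow_of_exponent_ge hh hh1 (by
      push_cast; rw [div_mul_cancel₀ _ (by norm_num)]; exact min_le_left _ _)
  have hy1 : y ≤ 1 := Real.rpow_le_one hh.le hh1 (by have := lt_min hβ one_pos
                                                     positivity)
  have hN : (⌈y⁻¹⌉₊ : ℝ) ≤ 2 * y⁻¹ := by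
    have h1 := (Nat.ceil_lt_add_one (inv_nonneg.2 hy0.le)).le
    have h2 := (one_le_inv₀ hy0).2 hy1
    linarith
  calc (⌈y⁻¹⌉₊ : ℝ) * (⌈y⁻¹⌉₊ * h ^ β) ≤ (2 * y⁻¹) * ((2 * y⁻¹) * y ^ 4) := by gcongr
    _ = 4 * y ^ 2 := by field_simp; ring

theorem exists_renewalMeasure_Ioc_le {Ω : Type*} [MeasurableSpace Ω] {P : Measure Ω}
    [IsProbabilityMeasure P] {Z : Ω → ℝ} (hZint : Integrable Z P) (hZmean : ∫ ω, Z ω ∂P ≠ 0)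
    {Y : ℕ → Ω → ℝ} (hYindep : iIndepFun Y P) (hYlaw : ∀ k, IdentDistrib (Y k) Z P P)
    (hnl : StronglyNonLattice P Z) :
    ∃ V : ℝ, 0 ≤ V ∧ (∀ x, renewalMeasure P Y (Ioc x (x + 1)) ≤ ENNReal.ofReal V) ∧
      ∃ ρ : ℝ, 0 < ρ ∧ ρ < 1 ∧ ∀ h : ℝ, 0 < h → h ≤ 1 → ∀ (x : ℝ) (N M : ℕ),
        ∑ n ∈ Finset.Ico N M, (P.map (walk Y n)).real (Ioc x (x + h)) ≤ V * (h + ρ ^ N) := by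
  have hZ := hZint.aemeasurable
  have : IsProbabilityMeasure (P.map Z) := Measure.isProbabilityMeasure_map hZ
  have hwm := aemeasurable_walk (P := P) fun k => (hYlaw k).aemeasurable_fst
  have : ∀ n, IsProbabilityMeasure (P.map (walk Y n)) :=
    fun n => Measure.isProbabilityMeasure_map (hwm n)
  have hν := charFun_map_walk hYindep hYlaw
  obtain ⟨ρ, hρ0, hρ1, T, hT, hout⟩ := hnl.exists_norm_charFun_le hZ
  obtain ⟨κ, hκ, hin⟩ := exists_quadratic_le_one_sub_norm_charFun _ hρ1 hT hout
  -- The quadratic bound covers `δ ≤ |t| ≤ T`, the non-lattice bound the rest.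
  have hsep : ∀ δ > 0, ∃ κ > 0, ∀ t, δ ≤ |t| → ‖charFun (P.map Z) t‖ ≤ 1 - κ := by
    intro δ hδ
    refine ⟨min (κ * δ ^ 2) (1 - ρ), lt_min (by positivity) (by linarith), fun t ht => ?_⟩
    rcases le_total |t| T with h | h
    · have h1 := hin t h
      have h2 : κ * δ ^ 2 ≤ κ * t ^ 2 := by
        rw [← sq_abs t]; gcongr
      linarith [min_le_left (κ * δ ^ 2) (1 - ρ)]
    · linarith [hout t h, min_le_right (κ * δ ^ 2) (1 - ρ)]
  obtain ⟨U, hU⟩ := exists_sum_integral_gaussian_le (P.map Z)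
    ((integrable_map_measure aestronglyMeasurable_id hZ).2 hZint)
    (by rwa [integral_map (f := fun z : ℝ => z) hZ aestronglyMeasurable_id]) hsep (fun n => P.map (walk Y n)) hν
  obtain ⟨C, hC0, hC⟩ := exists_sum_Ico_gaussian_sub_le (P.map Z) hρ0.le hρ1 hT hκ hout hin
    (fun n => P.map (walk Y n)) hν
  have hU0 : 0 ≤ U := by simpa using hU 0 0
  have hint0 : ∀ (x : ℝ) (n : ℕ),
      0 ≤ ∫ y, Real.exp (-((y - x) ^ 2 / 2)) ∂(P.map (walk Y n)) :=
    fun x n => integral_nonneg fun y => Real.exp_nonneg _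
  refine ⟨Real.exp (1 / 2) * (U + C), by positivity, fun x => ?_, ρ, hρ0, hρ1,
    fun h hh hh1 x N M => ?_⟩
  · refine renewalMeasure_le_ofReal measurableSet_Ioc fun M => ?_
    refine (Finset.sum_le_sum fun n _ =>
      measureReal_Ioc_le_integral_gaussian (P.map (walk Y n)) one_pos x).trans ?_
    rw [← Finset.mul_sum]
    simp only [one_pow, mul_one]
    exact mul_le_mul_of_nonneg_left (by linarith [hU x M]) (Real.exp_nonneg _)
  · refine (Finset.sum_le_sum fun n _ =>
      measureReal_Ioc_le_integral_gaussian (P.map (walk Y n)) hh x).trans ?_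
    rw [← Finset.mul_sum, mul_assoc]
    refine mul_le_mul_of_nonneg_left ?_ (Real.exp_nonneg _)
    have h1 := hC h hh hh1 x N M
    rw [Finset.sum_sub_distrib, ← Finset.mul_sum] at h1
    have h2 : ∑ n ∈ Finset.Ico N M, ∫ y, Real.exp (-((y - x) ^ 2 / 2)) ∂(P.map (walk Y n)) ≤ U :=
      (Finset.sum_le_sum_of_subset_of_nonneg (fun n hn => Finset.mem_range.2
        (Finset.mem_Ico.1 hn).2) fun n _ _ => hint0 x n).trans (hU x M)
    have h3 := mul_le_mul_of_nonneg_left h2 hh.le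
    have h4 : 0 ≤ U * ρ ^ N := by positivity
    linarith

end RenewalIncrement

/-! ### Assembly -/

theorem mainTheorem10 {Ω : Type*} [MeasurableSpace Ω] (P : Measure Ω) [IsProbabilityMeasure P]
    (Z : Ω → ℝ) (hZint : Integrable Z P) (hZpos : 0 < ∫ ω, Z ω ∂P)
    (Y : ℕ → Ω → ℝ) (hYindep : iIndepFun Y P) (hYlaw : ∀ k, IdentDistrib (Y k) Z P P)
    (r : ℝ) (hr : 0 < r)
    (htail : (fun x : ℝ => P.real {ω | x < Z ω}) =o[atTop] fun x : ℝ => Real.exp (-r * x))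
    (hnl : RenewalIncrement.StronglyNonLattice P Z)
    (β : ℝ) (hβ : 0 < β)
    (hcond : limsup (fun h : ℝ => ⨆ a : ℝ, ⨆ _ : 0 ≤ a,
        ENNReal.ofReal (h ^ (-β)) * P {ω | a < Z ω ∧ Z ω ≤ a + h}) (𝓝[>] (0 : ℝ)) < ∞) :
    ∃ β' : ℝ, 0 < β' ∧ ∃ c : ℝ, 0 < c ∧ ∀ x : ℝ, 0 ≤ x → ∀ h : ℝ, 0 ≤ h →
      RenewalIncrement.renewalMeasure P Y (Ioc x (x + h)) ≤ ENNReal.ofReal (c * max (h ^ β') h) ∧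
      (RenewalIncrement.renewalFunction P Y (x + h) < ∞ →
        (RenewalIncrement.renewalFunction P Y (x + h)).toReal
          - (RenewalIncrement.renewalFunction P Y x).toReal ≤ c * max (h ^ β') h) := by
  obtain ⟨V, hV0, hV1, ρ, hρ0, hρ1, hV⟩ :=
    RenewalIncrement.exists_renewalMeasure_Ioc_le hZint hZpos.ne' hYindep hYlaw hnl
  obtain ⟨A, hA0, h₀, hh₀, hA⟩ := RenewalIncrement.exists_holder_bound hcond
  have hρ : 0 < 1 - ρ := by linarith
  set γ := min β 1 / 4 with hγ
  have hγ0 : 0 < γ := by have := lt_min hβ one_pos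
                         positivity
  have hγ1 : γ ≤ 1 := by linarith [min_le_right β 1]
  set h₁ := min h₀ 1 with hh₁
  have hh₁0 : 0 < h₁ := lt_min hh₀ one_pos
  set c₁ := 4 * A + V * (1 + 1 / (1 - ρ)) with hc₁
  have hc₁0 : 0 ≤ c₁ := by positivity
  -- `c₁` serves `h < h₁`, the middle term serves `h ≥ h₁`, and the 1 makes `c` positive.
  set c := c₁ + (1 + 1 / h₁) * V + 1 with hc
  have hc0 : 0 < c := by positivity
  suffices key : ∀ x : ℝ, 0 ≤ x → ∀ h : ℝ, 0 ≤ h →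
      RenewalIncrement.renewalMeasure P Y (Ioc x (x + h)) ≤
        ENNReal.ofReal (c * max (h ^ γ) h) from
    ⟨γ, hγ0, c, hc0, fun x hx h hh => ⟨key x hx h hh,
      RenewalIncrement.toReal_renewalFunction_sub_le hh
        (mul_nonneg hc0.le (hh.trans (le_max_right _ _))) (key x hx h hh)⟩⟩
  intro x hx h hh
  rcases hh.eq_or_lt with rfl | hpos
  · simp
  rcases lt_or_ge h h₁ with hlt | hge
  · have hh1 : h ≤ 1 := hlt.le.trans (min_le_right _ _)
    have hy0 : 0 < h ^ γ := Real.rpow_pos_of_pos hpos _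
    have hy1 : h ^ γ ≤ 1 := Real.rpow_le_one hh hh1 hγ0.le
    have hhy : h ≤ h ^ γ := by
      simpa using Real.rpow_le_rpow_of_exponent_ge hpos hh1 hγ1
    have hle : RenewalIncrement.renewalMeasure P Y (Ioc x (x + h)) ≤
        ENNReal.ofReal (c₁ * h ^ γ) := by
      refine RenewalIncrement.renewalMeasure_le_ofReal measurableSet_Ioc fun M => ?_
      -- Large enough that `ρ ^ N = O(h ^ γ)`, small enough that `N² h ^ β = O(h ^ γ)`.
      set N := ⌈(h ^ γ)⁻¹⌉₊ with hN
      have hsplit : ∑ n ∈ Finset.range M, (P.map (RenewalIncrement.walk Y n)).real (Ioc x (x + h)) ≤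
          ∑ n ∈ Finset.range N, (P.map (RenewalIncrement.walk Y n)).real (Ioc x (x + h)) +
          ∑ n ∈ Finset.Ico N M, (P.map (RenewalIncrement.walk Y n)).real (Ioc x (x + h)) := by
        rw [← Finset.sum_union (Finset.disjoint_left.2 fun n h1 h2 => by
          have := Finset.mem_range.1 h1; have := (Finset.mem_Ico.1 h2).1; omega)]
        refine Finset.sum_le_sum_of_subset_of_nonneg (fun n hn => ?_) fun _ _ _ => measureReal_nonneg
        rw [Finset.mem_union, Finset.mem_range, Finset.mem_Ico]
        have := Finset.mem_range.1 hn; omega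
      have hfirst : ∑ n ∈ Finset.range N,
          (P.map (RenewalIncrement.walk Y n)).real (Ioc x (x + h)) ≤ 4 * A * h ^ γ := by
        have hAh : 0 ≤ A * h ^ β := by positivity
        have h1 : ∀ n ∈ Finset.range N,
            (P.map (RenewalIncrement.walk Y n)).real (Ioc x (x + h)) ≤ N * (A * h ^ β) := by
          intro n hn
          have h2 := RenewalIncrement.measure_walk_Ioc_le hYindep hYlaw hx
            (hA h hpos (hlt.trans_le (min_le_left _ _))) n
          rw [← ENNReal.ofReal_natCast, ← ENNReal.ofReal_mul (by positivity)] at h2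
          refine (ENNReal.toReal_le_of_le_ofReal (by positivity) h2).trans ?_
          have : (n : ℝ) ≤ N := by exact_mod_cast (Finset.mem_range.1 hn).le
          gcongr
        refine (Finset.sum_le_card_nsmul _ _ _ h1).trans ?_
        rw [Finset.card_range, nsmul_eq_mul]
        have h3 := RenewalIncrement.natCeil_mul_natCeil_mul_rpow_le hβ hpos hh1
        rw [← hγ, ← hN] at h3
        calc (N : ℝ) * (N * (A * h ^ β)) = A * (N * (N * h ^ β)) := by ring
          _ ≤ A * (4 * (h ^ γ) ^ 2) := by gcongr
          _ ≤ A * (4 * h ^ γ) := by gcongr; nlinarith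
          _ = 4 * A * h ^ γ := by ring
      have hsecond := hV h hpos hh1 x N M
      have hpow := RenewalIncrement.pow_le_inv_mul_of_inv_le hρ0.le hρ1 hy0 (Nat.le_ceil _)
      rw [← hN] at hpow
      have h4 : V * (h + ρ ^ N) ≤ V * (h ^ γ + 1 / (1 - ρ) * h ^ γ) := by gcongr
      rw [hc₁]
      linarith
    refine hle.trans (ENNReal.ofReal_le_ofReal ?_)
    refine mul_le_mul ?_ (le_max_left _ _) hy0.le hc0.le
    have : 0 ≤ (1 + 1 / h₁) * V := by positivity
    linarith
  · have hceil : (⌈h⌉₊ : ℝ) ≤ (1 + 1 / h₁) * h := by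
      have h1 := (Nat.ceil_lt_add_one hh).le
      have h2 : 1 ≤ 1 / h₁ * h := by rw [one_div_mul_eq_div, one_le_div hh₁0]; exact hge
      linarith
    calc RenewalIncrement.renewalMeasure P Y (Ioc x (x + h))
        ≤ RenewalIncrement.renewalMeasure P Y (Ioc x (x + ⌈h⌉₊)) :=
          measure_mono (Ioc_subset_Ioc_right (by linarith [Nat.le_ceil h]))
      _ ≤ ⌈h⌉₊ * ENNReal.ofReal V := RenewalIncrement.renewalMeasure_Ioc_nat_le hV1 x _
      _ = ENNReal.ofReal (⌈h⌉₊ * V) := by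
          rw [ENNReal.ofReal_mul (by positivity), ENNReal.ofReal_natCast]
      _ ≤ ENNReal.ofReal (c * max (h ^ γ) h) := by
          refine ENNReal.ofReal_le_ofReal ?_
          calc (⌈h⌉₊ : ℝ) * V ≤ (1 + 1 / h₁) * h * V := by gcongr
            _ = ((1 + 1 / h₁) * V) * h := by ring
            _ ≤ c * max (h ^ γ) h := by
              refine mul_le_mul (by linarith) (le_max_right _ _) hh hc0.le
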